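/- Let $G$ be a locally compact second countable (Hausdorff) topological group. A $G$-space $(X,\nu)$ is a standard Borel space $X$ with a Borel action $G\times X\to X$ and a probability measure $\nu$ on $X$ whose class of null sets is preserved by every $g\in G$. Write $g\nu$ for the translate $g\nu(E)=\nu(g^{-1}E)$. A $G$-map $\pi:(X,\nu)\to(Y,\eta)$ of $G$-spaces is a measurable map $\pi:X\to Y$ with $\pi_*\nu=\eta$ such that for every $g\in G$ one has $\pi(gx)=g\pi(x)$ for $\nu$-almost every $x$; then $(Y,\eta)$ is called a factor of $(X,\nu)$. A disintegration of $\nu$ over $\eta$ is a measurable map $D_\pi:Y\to P(X)$ into the probability measures on $X$ such that $D_\pi(y)$ is carried by $\pi^{-1}(y)$ for $\eta$-almost every $y$ and $\int_Y D_\pi(y)\,d\eta(y)=\nu$; it is unique up to $\eta$-null sets of $y$. Put $D_\pi^{(g)}(y)=g^{-1}D_\pi(gy)$. The $G$-map $\pi$ is relatively contractive if, for every version $D_\pi$ of the disintegration, for $\eta$-almost every $y\in Y$, every measurable $B\subseteq X$ with $D_\pi(y)(B)>0$ satisfies $\sup_{g\in G}D_\pi^{(g)}(y)(B)=1$. A $G$-space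 $(X,\nu)$ is contractive if $\sup_{g\in G}\nu(gB)=1$ for every measurable $B\subseteq X$ with $\nu(B)>0$, and measure-preserving if $g\nu=\nu$ for all $g\in G$. Theorem. Let $\pi:(X,\nu)\to(Y,\eta)$ and $\varphi:(Y,\eta)\to(Z,\rho)$ be $G$-maps of $G$-spaces. If $\varphi\circ\pi:(X,\nu)\to(Z,\rho)$ is relatively contractive, then both $\varphi$ and $\pi$ are relatively contractive. Corollary. Every factor of a contractive $G$-space is contractive, and every factor of a measure-preserving $G$-space is measure-preserving. -/

import Mathlib

open MeasureTheory ProbabilityTheory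

/-- A measure `ν` on `X` makes the measurable action of `G` on `X` a `G`-space: `ν` is a probability
measure and every `g ∈ G` preserves the class of `ν`-null sets. (That `X` is a standard Borel
space and that the action `G × X → X` is Borel are expressed by type classes.) -/
structure IsGSpace (G : Type*) [Group G] {X : Type*} [MeasurableSpace X] [MulAction G X]
    (ν : Measure X) : Prop where
  isProbabilityMeasure : IsProbabilityMeasure ν
  quasiInvariant : ∀ (g : G) (E : Set X), MeasurableSet E →
    (ν ((fun x => g • x) ⁻¹' E) = 0 ↔ ν E = 0)

/-- The translate `g ν` of a measure, `(g ν)(E) = ν (g⁻¹ E)`. -/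
noncomputable def measureTranslate {G : Type*} [Group G] {X : Type*} [MeasurableSpace X] [MulAction G X]
    (g : G) (ν : Measure X) : Measure X :=
  ν.map (fun x => g • x)

/-- `π : (X, ν) → (Y, η)` is a `G`-map: measurable, with `π_* ν = η`, and for every `g ∈ G`,
`π (g x) = g (π x)` for `ν`-almost every `x`. -/
structure IsGMap (G : Type*) [Group G] {X Y : Type*} [MeasurableSpace X] [MulAction G X]
    [MeasurableSpace Y] [MulAction G Y] (π : X → Y) (ν : Measure X) (η : Measure Y) : Prop where
  measurable : Measurable π
  map_eq : ν.map π = η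
  equivariant : ∀ g : G, ∀ᵐ x ∂ν, π (g • x) = g • π x

/-- `D : Y → P(X)` is (a version of) the disintegration of `ν` over `η` via `π`: a measurable
family of probability measures, with `D y` carried by the fibre `π⁻¹(y)` for `η`-almost every `y`,
and `∫ D y dη(y) = ν`. -/
structure IsDisintegration {X Y : Type*} [MeasurableSpace X] [MeasurableSpace Y]
    (π : X → Y) (ν : Measure X) (η : Measure Y) (D : Kernel Y X) : Prop where
  isMarkovKernel : IsMarkovKernel D
  fibre : ∀ᵐ y ∂η, D y (π ⁻¹' {y})ᶜ = 0
  bind_eq : η.bind D = ν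

/-- The conjugated disintegration measure `D^(g)(y) = g⁻¹ D(g y)`. -/
noncomputable def conjDisintegration {G : Type*} [Group G] {X Y : Type*} [MeasurableSpace X]
    [MulAction G X] [MeasurableSpace Y] [MulAction G Y] (D : Kernel Y X) (g : G) (y : Y) :
    Measure X :=
  measureTranslate g⁻¹ (D (g • y))

/-- `π` is relatively contractive: for almost every `y` and every measurable `B` with
`D_π(y)(B) > 0`, `sup_g D_π^(g)(y)(B) = 1`. The disintegration is only determined up to
null sets of `y`, while the supremum runs over a possibly uncountable group, so the condition is
required of every version of the disintegration. -/
def IsRelativelyContractive (G : Type*) [Group G] {X Y : Type*} [MeasurableSpace X]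
    [MulAction G X] [MeasurableSpace Y] [MulAction G Y] (π : X → Y) (ν : Measure X)
    (η : Measure Y) : Prop :=
  ∀ D : Kernel Y X, IsDisintegration π ν η D →
    ∀ᵐ y ∂η, ∀ B : Set X, MeasurableSet B → 0 < D y B →
      ⨆ g : G, conjDisintegration D g y B = 1

/-- The action on `(X, ν)` is contractive: `sup_g ν (g B) = 1` for every measurable `B` with
`ν B > 0`. -/
def IsContractive (G : Type*) [Group G] {X : Type*} [MeasurableSpace X] [MulAction G X]
    (ν : Measure X) : Prop :=
  ∀ B : Set X, MeasurableSet B → 0 < ν B → ⨆ g : G, ν ((fun x => g • x) '' B) = 1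

/-- The action on `(X, ν)` is measure-preserving: `g ν = ν` for all `g`. -/
def IsMeasurePreservingSpace (G : Type*) [Group G] {X : Type*} [MeasurableSpace X] [MulAction G X]
    (ν : Measure X) : Prop :=
  ∀ g : G, measureTranslate g ν = ν

/-!
Relative contractivity is a statement about every version of the disintegration and about sets
that depend on the point of the base; it does not pass to factors directly. It is equivalent to a
property that does, `FillsFibres`: for every non-null `B` and every `c < 1` some translate `g B`
has conditional probability above `c` on a non-null part of the base. Given `X → Y → Z`, this
property for `X → Z` implies it for `Y → Z` by applying it to preimages (`FillsFibres.bottom`), and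
for `X → Y` because a conditional probability over `Z` is an average of those over `Y`
(`FillsFibres.top`).

*Relatively contractive implies filling* (`IsRelativelyContractive.fillsFibres`). If `D w (g B) ≤ c`
for each `g` and almost every `w`, then for almost every `w` this holds for Haar-almost every `g`.
Redefining `D` on the remaining null set of `w` gives a version for which this is so at every `w`.
The average of `1_B` along the action over a set `U ⊆ G`, with respect to a finite measure
equivalent to Haar measure, then has `D w`-integral at most `c` after translation by every `g`, so
relative contractivity and Markov's inequality bound this average by `c' < 1` almost everywhere.
Letting `U` run through a countable dense family shows that `B` is null.

*Filling implies relatively contractive* (`FillsFibres.ae_iSup_eq_one`). Write `s z B` for the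
supremum over `g` of `g⁻¹ D (g z) B`. A measurable selection of sets `B` depending on `z` is avoided
by proving an inequality for all `B` at once. The measures `g⁻¹ D (g z)` are absolutely continuous
with respect to `D z`, and filling says that some of them are almost concentrated on any given
non-null set. An exhaustion argument covers `1_A` by countably many of them with total weight at
most `K ν(A)`, for every `K > 1`; letting `K → 1` yields `D z (A ∩ B) ≤ s z B * D z A` for almost
every `z` and every `B` (`FillsFibres.ae_measure_inter_le`). This holds simultaneously for all `A`
in a countable algebra generating the `σ`-algebra, hence for `A = B` by approximation, so that
`s z B ≥ 1` as soon as `D z B > 0`.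
-/

open scoped ENNReal

/-! ### Quasi-invariance and disintegrations -/

section Basic

variable {G : Type*} [Group G] [MeasurableSpace G]
  {X : Type*} [MeasurableSpace X] [MulAction G X] [MeasurableSMul₂ G X]
  {Y : Type*} [MeasurableSpace Y] [MulAction G Y]

theorem IsGSpace.quasiMeasurePreserving {ν : Measure X} (hν : IsGSpace G ν) (g : G) :
    Measure.QuasiMeasurePreserving (fun x => g • x) ν ν := by
  refine ⟨measurable_const_smul g, Measure.AbsolutelyContinuous.mk fun E hE h0 => ?_⟩
  rw [Measure.map_apply (measurable_const_smul g) hE]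
  exact (hν.quasiInvariant g E hE).2 h0

theorem IsGSpace.ae_smul_iff {ν : Measure X} (hν : IsGSpace G ν) (g : G) {p : X → Prop} :
    (∀ᵐ x ∂ν, p (g • x)) ↔ ∀ᵐ x ∂ν, p x := by
  refine ⟨fun h => ?_, fun h => (hν.quasiMeasurePreserving g).ae h⟩
  simpa using (hν.quasiMeasurePreserving g⁻¹).ae h

theorem conjDisintegration_apply (D : Kernel Y X) (g : G) (y : Y) {B : Set X}
    (hB : MeasurableSet B) :
    conjDisintegration D g y B = D (g • y) ((fun x => g⁻¹ • x) ⁻¹' B) := by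
  rw [conjDisintegration, measureTranslate, Measure.map_apply (measurable_const_smul _) hB]

theorem conjDisintegration_le_one {D : Kernel Y X} [IsMarkovKernel D] (g : G) (y : Y) {B : Set X}
    (hB : MeasurableSet B) : conjDisintegration D g y B ≤ 1 := by
  rw [conjDisintegration_apply _ _ _ hB]
  exact prob_le_one

theorem measurableSet_smul_preimage (g : G) {B : Set X} (hB : MeasurableSet B) :
    MeasurableSet ((fun x => g • x) ⁻¹' B) :=
  measurable_const_smul g hB

end Basic

section Disintegration

variable {X : Type*} [MeasurableSpace X] {Y : Type*} [MeasurableSpace Y]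
  {Z : Type*} [MeasurableSpace Z]
  {π : X → Y} {ν : Measure X} {η : Measure Y} {D : Kernel Y X}

theorem IsDisintegration.ae_ae (hD : IsDisintegration π ν η D) {p : X → Prop}
    (h : ∀ᵐ x ∂ν, p x) : ∀ᵐ y ∂η, ∀ᵐ x ∂(D y), p x := by
  rw [← hD.bind_eq] at h
  exact Measure.ae_ae_of_ae_bind D.aemeasurable h

theorem IsDisintegration.ae_fibre (hD : IsDisintegration π ν η D) :
    ∀ᵐ y ∂η, ∀ᵐ x ∂(D y), π x = y := by
  filter_upwards [hD.fibre] with y hy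
  exact hy

theorem IsDisintegration.lintegral_eq (hD : IsDisintegration π ν η D) {f : X → ℝ≥0∞}
    (hf : Measurable f) : ∫⁻ x, f x ∂ν = ∫⁻ y, ∫⁻ x, f x ∂(D y) ∂η := by
  conv_lhs => rw [← hD.bind_eq]
  exact Measure.lintegral_bind D.aemeasurable hf.aemeasurable

theorem IsDisintegration.apply_eq (hD : IsDisintegration π ν η D) {E : Set X}
    (hE : MeasurableSet E) : ν E = ∫⁻ y, D y E ∂η := by
  conv_lhs => rw [← hD.bind_eq]
  exact Measure.bind_apply hE D.aemeasurable

theorem IsDisintegration.of_ae_eq (hD : IsDisintegration π ν η D) {D' : Kernel Y X}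
    [IsMarkovKernel D'] (h : ∀ᵐ y ∂η, D' y = D y) : IsDisintegration π ν η D' := by
  refine ⟨inferInstance, ?_, ?_⟩
  · filter_upwards [hD.fibre, h] with y hy h
    rw [h, hy]
  · rw [← hD.bind_eq]
    exact Measure.bind_congr_right h

theorem exists_isDisintegration [StandardBorelSpace X] [StandardBorelSpace Y]
    [IsProbabilityMeasure ν] (hπ : Measurable π) (hη : ν.map π = η) :
    ∃ D : Kernel Y X, IsDisintegration π ν η D := by
  have : Nonempty X := nonempty_of_isProbabilityMeasure ν
  have hc : η ⊗ₘ condDistrib id π ν = ν.map fun x => (π x, x) := by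
    rw [← hη]; exact compProd_map_condDistrib (by fun_prop)
  have : IsProbabilityMeasure η := by
    rw [← hη]; exact Measure.isProbabilityMeasure_map hπ.aemeasurable
  refine ⟨condDistrib id π ν, inferInstance, ?_, ?_⟩
  · have h : ∀ᵐ p ∂(η ⊗ₘ condDistrib id π ν), π p.2 = p.1 := by
      have hm : MeasurableSet {p : Y × X | π p.2 = p.1} :=
        measurableSet_eq_fun (hπ.comp measurable_snd) measurable_fst
      rw [hc, ae_map_iff (by fun_prop) hm]
      exact Filter.Eventually.of_forall fun _ => rfl
    filter_upwards [Measure.ae_ae_of_ae_compProd h] with y hy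
    exact hy
  · have := condDistrib_comp_map (X := π) (Y := id) (μ := ν) hπ.aemeasurable (by fun_prop)
    rwa [hη, Measure.map_id] at this

/-- Disintegrations compose along a tower `X → Y → Z`. -/
theorem IsDisintegration.comp [MeasurableSingletonClass Z] {φ : Y → Z} {ρ : Measure Z}
    {E : Kernel Z Y} (hD : IsDisintegration π ν η D) (hE : IsDisintegration φ η ρ E)
    (hπ : Measurable π) (hφ : Measurable φ) :
    IsDisintegration (φ ∘ π) ν ρ (D ∘ₖ E) := by
  have := hD.isMarkovKernel
  have := hE.isMarkovKernel
  refine ⟨inferInstance, ?_, ?_⟩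
  · filter_upwards [hE.ae_ae hD.ae_fibre, hE.ae_fibre] with z h1 h2
    have hm : MeasurableSet {x | φ (π x) = z} := (hφ.comp hπ) (measurableSet_singleton z)
    change ∀ᵐ x ∂((D ∘ₖ E) z), φ (π x) = z
    rw [Kernel.ae_comp_iff hm]
    filter_upwards [h1, h2] with y hy hyz
    filter_upwards [hy] with x hx
    rw [hx, hyz]
  · rw [← Measure.comp_assoc, hE.bind_eq, hD.bind_eq]

end Disintegration

/-! ### The fibre-filling property -/

/-- The translates of sets of positive measure fill fibres: for every non-null `B` and every
`c < 1` there is `g` such that `D w (g B) > c` for a set of `w` of positive measure, i.e. the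
conditional probability of `g B` has essential supremum `1` over `g` and `w`. In contrast with
`IsRelativelyContractive`, the set `B` does not vary with the point of the base, and only null
sets of the base for a fixed `g` matter. The set `g B` is written as a preimage under `g⁻¹`. -/
def FillsFibres (G : Type*) [Group G] {X Z : Type*} [MeasurableSpace X] [MulAction G X]
    [MeasurableSpace Z] (ν : Measure X) (ρ : Measure Z) (D : Kernel Z X) : Prop :=
  ∀ B : Set X, MeasurableSet B → ν B ≠ 0 → ∀ c : ℝ≥0∞, c < 1 →
    ∃ g : G, ¬ ∀ᵐ w ∂ρ, D w ((fun x => g⁻¹ • x) ⁻¹' B) ≤ c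

section Inherit

variable {G : Type*} [Group G] [MeasurableSpace G]
  {X : Type*} [MeasurableSpace X] [MulAction G X]
  {Y : Type*} [MeasurableSpace Y]
  {Z : Type*} [MeasurableSpace Z]
  {π : X → Y} {φ : Y → Z} {ν : Measure X} {η : Measure Y} {ρ : Measure Z}
  {D : Kernel Y X} {E : Kernel Z Y}

/-- The filling property of `X → Z` passes to `Y → Z` in a tower `X → Y → Z`: the image of
`(D ∘ₖ E) w` in `Y` is `E w` for almost every `w`. -/
theorem FillsFibres.bottom [MulAction G Y] [MeasurableSMul₂ G Y]
    [MeasurableSingletonClass Z] (hπ : IsGMap G π ν η) (hφ : Measurable φ)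
    (hD : IsDisintegration π ν η D) (hE : IsDisintegration φ η ρ E)
    (h : FillsFibres G ν ρ (D ∘ₖ E)) : FillsFibres G η ρ E := by
  intro B hB hηB c hc
  have hπm := hπ.measurable
  rw [← hπ.map_eq, Measure.map_apply hπm hB] at hηB
  obtain ⟨g, hg⟩ := h _ (hπm hB) hηB c hc
  refine ⟨g, fun hcon => hg ?_⟩
  have hgB : MeasurableSet ((fun y : Y => g⁻¹ • y) ⁻¹' B) := measurableSet_smul_preimage _ hB
  have hDE := hD.comp hE hπm hφ
  filter_upwards [hcon, hDE.ae_ae (hπ.equivariant g⁻¹), hE.ae_ae hD.ae_fibre] with w h1 h2 h3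
  calc (D ∘ₖ E) w ((fun x => g⁻¹ • x) ⁻¹' (π ⁻¹' B))
      = (D ∘ₖ E) w (π ⁻¹' ((fun y => g⁻¹ • y) ⁻¹' B)) := by
        refine measure_congr ?_
        filter_upwards [h2] with x hx
        exact congrArg (· ∈ B) hx
    _ = ∫⁻ y, D y (π ⁻¹' ((fun y => g⁻¹ • y) ⁻¹' B)) ∂(E w) := Kernel.comp_apply' _ _ _ (hπm hgB)
    _ ≤ ∫⁻ y, ((fun y => g⁻¹ • y) ⁻¹' B).indicator 1 y ∂(E w) := by
        have := hD.isMarkovKernel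
        refine lintegral_mono_ae ?_
        filter_upwards [h3] with y hy
        by_cases hyB : y ∈ (fun y => g⁻¹ • y) ⁻¹' B
        · simpa [Set.indicator_of_mem hyB] using prob_le_one
        · rw [Set.indicator_of_notMem hyB, nonpos_iff_eq_zero, measure_eq_zero_iff_ae_notMem]
          filter_upwards [hy] with x hx hxB
          exact hyB (by rwa [← hx])
    _ = E w ((fun y => g⁻¹ • y) ⁻¹' B) := lintegral_indicator_one hgB
    _ ≤ c := h1

/-- The filling property of `X → Z` passes to `X → Y` in a tower `X → Y → Z`. -/
theorem FillsFibres.top [MeasurableSMul₂ G X] (hE : IsDisintegration φ η ρ E)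
    (h : FillsFibres G ν ρ (D ∘ₖ E)) : FillsFibres G ν η D := by
  intro B hB hνB c hc
  obtain ⟨g, hg⟩ := h B hB hνB c hc
  refine ⟨g, fun hcon => hg ?_⟩
  have := hE.isMarkovKernel
  filter_upwards [hE.ae_ae hcon] with w hw
  rw [Kernel.comp_apply' _ _ _ (measurableSet_smul_preimage _ hB)]
  calc _ ≤ ∫⁻ _, c ∂(E w) := lintegral_mono_ae hw
    _ = c := by simp

end Inherit

/-! ### Relative contractivity implies the fibre-filling property -/

/-- If `B` has proportion at most `s` in each member of a dense family, then it does in itself, as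
it is approximated by members of the family. -/
theorem measure_le_mul_of_measureDense {α : Type*} [MeasurableSpace α] {μ : Measure α}
    [IsFiniteMeasure μ] {𝒜 : Set (Set α)} (h𝒜 : μ.MeasureDense 𝒜) {B : Set α}
    (hB : MeasurableSet B) {s : ℝ≥0∞} (hs : s ≤ 1)
    (h : ∀ A ∈ 𝒜, μ (A ∩ B) ≤ s * μ A) : μ B ≤ s * μ B := by
  refine ENNReal.le_of_forall_pos_le_add fun ε hε _ => ?_
  obtain ⟨A, hA, hAB⟩ := h𝒜.approx B hB (measure_ne_top _ _) (ε / 2) (by positivity)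
  have hAB : μ (symmDiff B A) ≤ ENNReal.ofReal (ε / 2) := hAB.le
  have e : ENNReal.ofReal (ε / 2) + ENNReal.ofReal (ε / 2) = ε := by
    rw [← ENNReal.ofReal_add (by positivity) (by positivity), add_halves]; simp
  have h1 : μ B ≤ μ (A ∩ B) + μ (symmDiff B A) :=
    (measure_mono fun x hx => by
      by_cases hxA : x ∈ A
      · exact Or.inl ⟨hxA, hx⟩
      · exact Or.inr (Or.inl ⟨hx, hxA⟩)).trans (measure_union_le _ _)
  have h2 : μ A ≤ μ B + μ (symmDiff B A) :=
    (measure_mono fun x hx => by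
      by_cases hxB : x ∈ B
      · exact Or.inl hxB
      · exact Or.inr (Or.inr ⟨hx, hxB⟩)).trans (measure_union_le _ _)
  calc μ B ≤ s * μ A + ENNReal.ofReal (ε / 2) := h1.trans (add_le_add (h A hA) hAB)
    _ ≤ s * (μ B + ENNReal.ofReal (ε / 2)) + ENNReal.ofReal (ε / 2) := by
      gcongr
      exact h2.trans (by gcongr)
    _ ≤ s * μ B + (ENNReal.ofReal (ε / 2) + ENNReal.ofReal (ε / 2)) := by
      rw [mul_add, add_assoc]
      gcongr
      exact mul_le_of_le_one_left' hs
    _ = s * μ B + ε := by rw [e]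

/-- Relative contractivity implies the filling property. Equivariance of `ψ` plays no role: only the
quasi-invariance of `ν` and the freedom to change the disintegration on a null set do. -/
theorem IsRelativelyContractive.fillsFibres {G : Type*} [Group G] [TopologicalSpace G]
    [IsTopologicalGroup G] [LocallyCompactSpace G] [SecondCountableTopology G]
    [MeasurableSpace G] [BorelSpace G]
    {X : Type*} [MeasurableSpace X] [MulAction G X] [MeasurableSMul₂ G X]
    {Z : Type*} [MeasurableSpace Z] [MulAction G Z]
    {ψ : X → Z} {ν : Measure X} {ρ : Measure Z} {D : Kernel Z X}
    (h : IsRelativelyContractive G ψ ν ρ) (hν : IsGSpace G ν) [IsProbabilityMeasure ρ]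
    (hD : IsDisintegration ψ ν ρ D) : FillsFibres G ν ρ D := by
  intro B hB hνB c hc
  by_contra! hcon
  have := hD.isMarkovKernel
  have := hν.isProbabilityMeasure
  set p : Measure G := (Measure.haar : Measure G).toFinite with hp
  have hmul : ∀ {g : G} {q : G → Prop}, (∀ᵐ k ∂p, q k) → ∀ᵐ h ∂p, q (g * h⁻¹) := by
    intro g q hq
    rw [hp, ae_toFinite] at hq ⊢
    simpa [div_eq_mul_inv] using
      (quasiMeasurePreserving_div_left (Measure.haar : Measure G) g).ae hq
  -- At almost every point `w` the bound holds for almost every group element.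
  have hgood : ∀ᵐ w ∂ρ, ∀ᵐ k ∂p, D w ((fun x => k⁻¹ • x) ⁻¹' B) ≤ c := by
    rw [Measure.ae_ae_comm]
    · exact Filter.Eventually.of_forall hcon
    · have hm : MeasurableSet {q : (Z × G) × X | q.1.2⁻¹ • q.2 ∈ B} :=
        (by fun_prop : Measurable fun q : (Z × G) × X => q.1.2⁻¹ • q.2) hB
      exact measurableSet_le
        (Kernel.measurable_kernel_prodMk_left (κ := Kernel.prodMkRight G D) hm) measurable_const
  obtain ⟨N, hN, hNm, hN0⟩ := exists_measurable_superset_of_null (ae_iff.1 hgood)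
  have hNc : ∀ w ∉ N, ∀ᵐ k ∂p, D w ((fun x => k⁻¹ • x) ⁻¹' B) ≤ c := fun w hw => by
    by_contra hw'
    exact hw (hN hw')
  obtain ⟨w₀, hw₀⟩ : ∃ w, w ∉ N := by
    by_contra! hall
    rw [Set.eq_univ_of_forall hall, measure_univ] at hN0
    exact one_ne_zero hN0
  classical
  -- The version of the disintegration that is constant on the exceptional null set satisfies the
  -- bound at every point.
  let D' : Kernel Z X := Kernel.piecewise hNm (Kernel.const Z (D w₀)) D
  have hD'eq : ∀ w, D' w = if w ∈ N then D w₀ else D w := fun w => by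
    rw [Kernel.piecewise_apply, Kernel.const_apply]
  have hD' : IsDisintegration ψ ν ρ D' := by
    refine hD.of_ae_eq ?_
    filter_upwards [measure_eq_zero_iff_ae_notMem.1 hN0] with w hw
    rw [hD'eq, if_neg hw]
  have hall : ∀ w, ∀ᵐ k ∂p, D' w ((fun x => k⁻¹ • x) ⁻¹' B) ≤ c := fun w => by
    rw [hD'eq]
    split_ifs with hw
    exacts [hNc _ hw₀, hNc _ hw]
  have hact : MeasurableSet {q : X × G | q.2 • q.1 ∈ B} :=
    (by fun_prop : Measurable fun q : X × G => q.2 • q.1) hB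
  have hfm : ∀ U : Set G, MeasurableSet U → Measurable fun x => p ({h | h • x ∈ B} ∩ U) := by
    intro U hU
    simp_rw [← Measure.restrict_apply' hU]
    exact measurable_measure_prodMk_left hact
  -- Averaging over `U ⊆ G` turns "almost every group element" into "every group element".
  have hint : ∀ U : Set G, MeasurableSet U → ∀ (g : G) (w : Z),
      ∫⁻ x, p ({h | h • g⁻¹ • x ∈ B} ∩ U) ∂(D' w) ≤ c * p U := by
    intro U hU g w
    have hm : MeasurableSet {q : X × G | q.2 • g⁻¹ • q.1 ∈ B} :=
      (by fun_prop : Measurable fun q : X × G => q.2 • g⁻¹ • q.1) hB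
    calc ∫⁻ x, p ({h | h • g⁻¹ • x ∈ B} ∩ U) ∂(D' w)
        = ((D' w).prod (p.restrict U)) {q : X × G | q.2 • g⁻¹ • q.1 ∈ B} := by
          rw [Measure.prod_apply hm]
          simp_rw [Measure.restrict_apply' hU]
          rfl
      _ = ∫⁻ h in U, D' w {x | h • g⁻¹ • x ∈ B} ∂p := by
          rw [Measure.prod_apply_symm hm]
          rfl
      _ ≤ ∫⁻ _ in U, c ∂p := by
          refine lintegral_mono_ae (ae_restrict_of_ae ?_)
          filter_upwards [hmul (g := g) (hall w)] with h hh
          have e : (fun x : X => (g * h⁻¹)⁻¹ • x) ⁻¹' B = {x | h • g⁻¹ • x ∈ B} := by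
            ext x; simp [mul_smul]
          rwa [e] at hh
      _ = c * p U := by simp
  obtain ⟨c', hcc', hc'⟩ := exists_between hc
  have hnull : ∀ U : Set G, MeasurableSet U →
      ∀ᵐ x ∂ν, p ({h | h • x ∈ B} ∩ U) ≤ c' * p U := by
    intro U hU
    by_cases hU0 : p U = 0
    · refine Filter.Eventually.of_forall fun x => ?_
      rw [hU0, mul_zero, nonpos_iff_eq_zero]
      exact measure_mono_null Set.inter_subset_right hU0
    have hB' : MeasurableSet {x | c' * p U < p ({h | h • x ∈ B} ∩ U)} :=
      measurableSet_lt measurable_const (hfm U hU)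
    have hc'0 : c' ≠ 0 := (zero_le.trans_lt hcc').ne'
    suffices hz : ∀ᵐ z ∂ρ, D' z {x | c' * p U < p ({h | h • x ∈ B} ∩ U)} = 0 by
      have : ν {x | c' * p U < p ({h | h • x ∈ B} ∩ U)} = 0 := by
        rw [hD'.apply_eq hB', lintegral_congr_ae hz, lintegral_zero]
      simpa [ae_iff] using this
    filter_upwards [h D' hD'] with z hz
    by_contra hne
    have hsup := hz _ hB' (pos_iff_ne_zero.2 hne)
    have hle : ∀ g : G, conjDisintegration D' g z {x | c' * p U < p ({h | h • x ∈ B} ∩ U)}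
        ≤ c / c' := by
      intro g
      rw [conjDisintegration_apply _ _ _ hB', ENNReal.le_div_iff_mul_le (Or.inl hc'0)
        (Or.inl hc'.ne_top)]
      have h1 := mul_meas_ge_le_lintegral (μ := D' (g • z))
        ((hfm U hU).comp (measurable_const_smul g⁻¹)) (c' * p U)
      have h2 : c' * p U * D' (g • z)
          ((fun x => g⁻¹ • x) ⁻¹' {x | c' * p U < p ({h | h • x ∈ B} ∩ U)}) ≤ c * p U :=
        le_trans (mul_le_mul_right (measure_mono fun x hx =>
          le_of_lt (show c' * p U < p ({h | h • g⁻¹ • x ∈ B} ∩ U) from hx)) _) (h1.trans (hint U hU g _))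
      rw [mul_right_comm] at h2
      rw [mul_comm _ c']
      exact (ENNReal.mul_le_mul_iff_left hU0 (measure_ne_top _ _)).1 h2
    have : c / c' < 1 := by
      rw [ENNReal.div_lt_iff (Or.inl hc'0) (Or.inl hc'.ne_top), one_mul]
      exact hcc'
    exact absurd hsup (ne_of_lt ((iSup_le hle).trans_lt this))
  obtain ⟨𝒜, h𝒜c, h𝒜⟩ := exists_countable_measureDense (μ := p)
  have hO : ∀ᵐ x ∂ν, p {h | h • x ∈ B} = 0 := by
    have : ∀ᵐ x ∂ν, ∀ U ∈ 𝒜, p ({h | h • x ∈ B} ∩ U) ≤ c' * p U :=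
      (ae_ball_iff h𝒜c).2 fun U hU => hnull U (h𝒜.measurable U hU)
    filter_upwards [this] with x hx
    have hxm : MeasurableSet {h : G | h • x ∈ B} := (measurable_smul_const x) hB
    have hle := measure_le_mul_of_measureDense h𝒜 hxm hc'.le
      fun A hA => by rw [Set.inter_comm]; exact hx A hA
    by_contra hne
    refine absurd hle (not_le.2 ?_)
    calc c' * p {h | h • x ∈ B} < 1 * p {h | h • x ∈ B} :=
          (ENNReal.mul_lt_mul_iff_left hne (measure_ne_top _ _)).2 hc'
      _ = _ := one_mul _
  have hswap : ∀ᵐ h ∂p, ∀ᵐ x ∂ν, h • x ∉ B := by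
    rw [Measure.ae_ae_comm]
    · filter_upwards [hO] with x hx
      exact measure_eq_zero_iff_ae_notMem.1 hx
    · exact ((by fun_prop : Measurable fun q : G × X => q.1 • q.2) hB).compl
  have : (ae p).NeBot := by
    rw [hp, ae_toFinite]; infer_instance
  obtain ⟨g, hg⟩ := hswap.exists
  exact hνB ((hν.quasiInvariant g B hB).1 (measure_eq_zero_iff_ae_notMem.2 hg))

/-! ### Exhaustion by functions dominated along the fibres -/

/-- Exhaustion: if below every function of non-zero integral there is one of non-zero integral
that belongs to the class `P`, then every integrable `f` is almost everywhere a countable sum of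
members of `P`. -/
theorem exists_tsum_ae_eq {α : Type*} [MeasurableSpace α] {μ : Measure α}
    {P : (α → ℝ≥0∞) → Prop} (hP0 : P 0)
    (hP : ∀ f : α → ℝ≥0∞, Measurable f → ∫⁻ x, f x ∂μ ≠ 0 →
      ∃ u, Measurable u ∧ u ≤ f ∧ P u ∧ ∫⁻ x, u x ∂μ ≠ 0)
    {f : α → ℝ≥0∞} (hf : Measurable f) (hfi : ∫⁻ x, f x ∂μ ≠ ∞) :
    ∃ u : ℕ → α → ℝ≥0∞, (∀ n, Measurable (u n)) ∧ (∀ n, P (u n)) ∧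
      (fun x => ∑' n, u n x) =ᵐ[μ] f := by
  -- Greedy choice: up to a factor `2`, `F f` is the largest member of `P` below `f`.
  have hgreedy : ∀ f : {f : α → ℝ≥0∞ // Measurable f ∧ ∫⁻ x, f x ∂μ ≠ ∞},
      ∃ u, Measurable u ∧ u ≤ f.1 ∧ P u ∧
        ∀ v, Measurable v → v ≤ f.1 → P v → ∫⁻ x, v x ∂μ ≤ 2 * ∫⁻ x, u x ∂μ := by
    rintro ⟨f, hf, hfi⟩
    set s : ℝ≥0∞ := ⨆ (v : α → ℝ≥0∞) (_ : Measurable v ∧ v ≤ f ∧ P v), ∫⁻ x, v x ∂μ with hs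
    have hle : ∀ v, Measurable v → v ≤ f → P v → ∫⁻ x, v x ∂μ ≤ s := fun v h1 h2 h3 =>
      le_iSup₂ (f := fun (v : α → ℝ≥0∞) (_ : Measurable v ∧ v ≤ f ∧ P v) => ∫⁻ x, v x ∂μ)
        v ⟨h1, h2, h3⟩
    have hs_top : s ≠ ∞ := ne_top_of_le_ne_top hfi
      (iSup₂_le fun v hv => lintegral_mono hv.2.1)
    by_cases hs0 : s = 0
    · exact ⟨0, measurable_zero, fun _ => zero_le, hP0, fun v h1 h2 h3 => by
        simpa [hs0] using hle v h1 h2 h3⟩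
    · have hlt : s / 2 < s := ENNReal.half_lt_self hs0 hs_top
      obtain ⟨u, hlt⟩ := lt_iSup_iff.1 (hlt.trans_eq hs)
      obtain ⟨hu, hlt⟩ := lt_iSup_iff.1 hlt
      refine ⟨u, hu.1, hu.2.1, hu.2.2, fun v h1 h2 h3 => (hle v h1 h2 h3).trans ?_⟩
      have := mul_le_mul_right hlt.le 2
      rwa [ENNReal.mul_div_cancel two_ne_zero ENNReal.ofNat_ne_top] at this
  choose F hFm hFle hFP hFmax using hgreedy
  let r : ℕ → {f : α → ℝ≥0∞ // Measurable f ∧ ∫⁻ x, f x ∂μ ≠ ∞} := fun n =>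
    Nat.rec ⟨f, hf, hfi⟩ (fun _ f => ⟨fun x => f.1 x - F f x, f.2.1.sub (hFm f),
      ne_top_of_le_ne_top f.2.2 (lintegral_mono fun x => tsub_le_self)⟩) n
  have hrs : ∀ n x, (r (n + 1)).1 x = (r n).1 x - F (r n) x := fun n x => rfl
  have hsum : ∀ n x, ∑ i ∈ Finset.range n, F (r i) x + (r n).1 x = f x := by
    intro n x
    induction n with
    | zero => simp [r]
    | succ n ih =>
      rw [Finset.sum_range_succ, hrs, add_assoc, add_tsub_cancel_of_le (hFle (r n) x), ih]
  have hle : ∀ x, ∑' n, F (r n) x ≤ f x := fun x => ENNReal.tsum_le_of_sum_range_le fun n => by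
    rw [← hsum n x]
    exact le_self_add
  refine ⟨fun n => F (r n), fun n => hFm _, fun n => hFP _, ?_⟩
  have hint : Filter.Tendsto (fun n => ∫⁻ x, F (r n) x ∂μ) Filter.atTop (nhds 0) := by
    refine ENNReal.tendsto_atTop_zero_of_tsum_ne_top ?_
    rw [← lintegral_tsum fun n => (hFm _).aemeasurable]
    exact ne_top_of_le_ne_top hfi (lintegral_mono hle)
  have hres : ∫⁻ x, ⨅ n, (r n).1 x ∂μ = 0 := by
    by_contra hne
    obtain ⟨u, hum, hule, huP, hu0⟩ := hP _ (Measurable.iInf fun n => (r n).2.1) hne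
    have h2 : ∀ n, ∫⁻ x, u x ∂μ ≤ 2 * ∫⁻ x, F (r n) x ∂μ := fun n =>
      hFmax (r n) u hum (fun x => (hule x).trans (iInf_le _ n)) huP
    have h3 := ge_of_tendsto' (ENNReal.Tendsto.const_mul hint (Or.inr ENNReal.ofNat_ne_top)) h2
    rw [mul_zero, nonpos_iff_eq_zero] at h3
    exact hu0 h3
  rw [lintegral_eq_zero_iff (Measurable.iInf fun n => (r n).2.1)] at hres
  filter_upwards [hres] with x hx
  refine le_antisymm (hle x) ?_
  have : f x ≤ ∑' n, F (r n) x + ⨅ n, (r n).1 x := by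
    rw [ENNReal.add_iInf]
    refine le_iInf fun n => ?_
    rw [← hsum n x]
    gcongr
    exact ENNReal.sum_le_tsum _
  rwa [hx, Pi.zero_apply, add_zero] at this

/-- `u` is dominated along the fibres with constant `K`: there is a weight `b` on the base, of
total mass at most `K * ∫ u`, such that for almost every `z` the measure with density `u` with
respect to `D z` is bounded, on every set `B`, by `b z` times the supremum over `g` of the
conjugated disintegration measures of `B`. This holds in particular if the measure with density
`u` is at most a countable sum of measures `g⁻¹ D (g z)` with weights adding up to `b z`. -/
def DominatedAlongFibres (G : Type*) [Group G] {X Z : Type*} [MeasurableSpace X] [MulAction G X]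
    [MeasurableSpace Z] [MulAction G Z] (ν : Measure X) (ρ : Measure Z) (D : Kernel Z X)
    (K : ℝ≥0∞) (u : X → ℝ≥0∞) : Prop :=
  ∃ b : Z → ℝ≥0∞, Measurable b ∧ ∫⁻ z, b z ∂ρ ≤ K * ∫⁻ x, u x ∂ν ∧
    ∀ᵐ z ∂ρ, ∀ B : Set X, MeasurableSet B →
      ∫⁻ x in B, u x ∂(D z) ≤ b z * ⨆ g : G, conjDisintegration D g z B

section Dominated

variable {G : Type*} [Group G] {X : Type*} [MeasurableSpace X] [MulAction G X]
  {Z : Type*} [MeasurableSpace Z] [MulAction G Z]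
  {ψ : X → Z} {ν : Measure X} {ρ : Measure Z} {D : Kernel Z X} {K : ℝ≥0∞}

theorem DominatedAlongFibres.zero : DominatedAlongFibres G ν ρ D K 0 :=
  ⟨0, measurable_zero, by simp, by simp⟩

theorem DominatedAlongFibres.const_mul {u : X → ℝ≥0∞} (hu : Measurable u)
    (h : DominatedAlongFibres G ν ρ D K u) (r : ℝ≥0∞) :
    DominatedAlongFibres G ν ρ D K fun x => r * u x := by
  obtain ⟨b, hb, hbi, hbd⟩ := h
  refine ⟨fun z => r * b z, hb.const_mul r, ?_, ?_⟩
  · rw [lintegral_const_mul _ hb, lintegral_const_mul _ hu, mul_left_comm]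
    gcongr
  · filter_upwards [hbd] with z hz B hB
    rw [lintegral_const_mul _ hu, mul_assoc]
    gcongr
    exact hz B hB

theorem DominatedAlongFibres.tsum {u : ℕ → X → ℝ≥0∞} (hu : ∀ n, Measurable (u n))
    (h : ∀ n, DominatedAlongFibres G ν ρ D K (u n)) :
    DominatedAlongFibres G ν ρ D K fun x => ∑' n, u n x := by
  choose b hb hbi hbd using h
  refine ⟨fun z => ∑' n, b n z, Measurable.tsum hb, ?_, ?_⟩
  · rw [lintegral_tsum fun n => (hb n).aemeasurable, lintegral_tsum fun n => (hu n).aemeasurable,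
      ← ENNReal.tsum_mul_left]
    exact ENNReal.tsum_le_tsum hbi
  · filter_upwards [ae_all_iff.2 hbd] with z hz B hB
    rw [lintegral_tsum fun n => (hu n).aemeasurable, ← ENNReal.tsum_mul_right]
    exact ENNReal.tsum_le_tsum fun n => hz n B hB

theorem DominatedAlongFibres.congr {u v : X → ℝ≥0∞} (hD : IsDisintegration ψ ν ρ D)
    (huv : u =ᵐ[ν] v) (h : DominatedAlongFibres G ν ρ D K u) :
    DominatedAlongFibres G ν ρ D K v := by
  obtain ⟨b, hb, hbi, hbd⟩ := h
  refine ⟨b, hb, by rwa [← lintegral_congr_ae huv], ?_⟩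
  filter_upwards [hbd, hD.ae_ae huv] with z hz he B hB
  rw [← lintegral_congr_ae (ae_restrict_of_ae he)]
  exact hz B hB

end Dominated

section Converse

variable {G : Type*} [Group G] [MeasurableSpace G]
  {X : Type*} [MeasurableSpace X] [MulAction G X] [MeasurableSMul₂ G X]
  {Z : Type*} [MeasurableSpace Z] [MulAction G Z] [MeasurableSMul₂ G Z]
  {ψ : X → Z} {ν : Measure X} {ρ : Measure Z} {D : Kernel Z X} {K : ℝ≥0∞}

/-- The family `z ↦ g⁻¹ D (g z)` as a kernel. -/
noncomputable def conjKernel (D : Kernel Z X) (g : G) : Kernel Z X :=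
  (D.comap (fun z => g • z) (measurable_const_smul g)).map fun x => g⁻¹ • x

theorem conjKernel_apply (D : Kernel Z X) (g : G) (z : Z) :
    conjKernel D g z = conjDisintegration D g z := by
  rw [conjKernel, Kernel.map_apply _ (measurable_const_smul _), Kernel.comap_apply]
  rfl

/-- For almost every `z`, the measure `g⁻¹ D (g z)` has no singular part with respect to `D z`. The
two families integrate to equivalent measures on `X`, and almost every `g⁻¹ D (g z)` lives on the
fibre over `z` because the map is equivariant almost everywhere. -/
theorem IsDisintegration.ae_conjKernel_absolutelyContinuous
    [MeasurableSpace.CountablyGenerated X] (hν : IsGSpace G ν) (hρ : IsGSpace G ρ)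
    (hψ : IsGMap G ψ ν ρ) (hD : IsDisintegration ψ ν ρ D) (g : G) :
    ∀ᵐ z ∂ρ, conjKernel D g z ≪ D z := by
  have := hD.isMarkovKernel
  have := hρ.isProbabilityMeasure
  have : IsMarkovKernel (conjKernel D g) := by
    unfold conjKernel
    exact Kernel.IsMarkovKernel.map _ (measurable_const_smul _)
  refine Measure.AbsolutelyContinuous.kernel_of_compProd (ν := ρ)
    (Measure.AbsolutelyContinuous.mk fun E hE h0 => ?_)
  -- `E` is null for `ρ ⊗ₘ D`, the image of `ν` under `x ↦ (ψ x, x)`.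
  have hE0 : ∀ᵐ x ∂ν, (ψ x, x) ∉ E := by
    have hm : MeasurableSet {x | (ψ x, x) ∈ E} := (hψ.measurable.prodMk measurable_id) hE
    refine measure_eq_zero_iff_ae_notMem.1 (?_ : ν {x | (ψ x, x) ∈ E} = 0)
    rw [hD.apply_eq hm, ← h0, Measure.compProd_apply hE]
    refine lintegral_congr_ae ?_
    filter_upwards [hD.ae_fibre] with z hz
    refine measure_congr ?_
    filter_upwards [hz] with x hx
    exact congrArg (fun w => (w, x) ∈ E) hx
  rw [Measure.compProd_apply hE, lintegral_eq_zero_iff (Kernel.measurable_kernel_prodMk_left hE)]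
  have hw : ∀ᵐ w ∂ρ, D w {x | (g⁻¹ • w, g⁻¹ • x) ∈ E} = 0 := by
    filter_upwards [hD.ae_fibre, hD.ae_ae (hψ.equivariant g⁻¹),
      hD.ae_ae ((hν.ae_smul_iff g⁻¹).2 hE0)] with w h1 h2 h3
    rw [measure_eq_zero_iff_ae_notMem]
    filter_upwards [h1, h2, h3] with x hx1 hx2 hx3
    rw [hx2, hx1] at hx3
    exact hx3
  filter_upwards [(hρ.ae_smul_iff g).2 hw] with z hz
  rw [conjKernel_apply, conjDisintegration_apply _ _ _ (measurable_prodMk_left hE)]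
  change D (g • z) {x | (z, g⁻¹ • x) ∈ E} = 0
  simpa using hz

/-- A set of positive measure supports a non-trivial function dominated along the fibres. The
translate filling a proportion `c > K⁻¹` of the fibres over some set `W` provides measures
`g⁻¹ D (g z)`, `z ∈ W`, that are concentrated on `B` up to this proportion; the function is a
truncation of their density. -/
theorem FillsFibres.exists_dominated [MeasurableSpace.CountablyGenerated X]
    (h : FillsFibres G ν ρ D) (hν : IsGSpace G ν) (hρ : IsGSpace G ρ)
    (hψ : IsGMap G ψ ν ρ) (hD : IsDisintegration ψ ν ρ D) (hK : 1 < K) {B : Set X}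
    (hB : MeasurableSet B) (hνB : ν B ≠ 0) :
    ∃ u : X → ℝ≥0∞, Measurable u ∧ u ≤ B.indicator 1 ∧ DominatedAlongFibres G ν ρ D K u ∧
      ∫⁻ x, u x ∂ν ≠ 0 := by
  have := hD.isMarkovKernel
  have := hρ.isProbabilityMeasure
  obtain ⟨c, hKc, hc⟩ := exists_between (ENNReal.inv_lt_one.2 hK)
  obtain ⟨g, hg⟩ := h B hB hνB c hc
  rw [← hρ.ae_smul_iff g] at hg
  have : IsMarkovKernel (conjKernel D g) := by
    unfold conjKernel
    exact Kernel.IsMarkovKernel.map _ (measurable_const_smul _)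
  set W : Set Z := {z | c < conjKernel D g z B} with hWdef
  have hW : MeasurableSet W := measurableSet_lt measurable_const (Kernel.measurable_coe _ hB)
  have hW0 : ρ W ≠ 0 := by
    intro h0
    refine hg ?_
    filter_upwards [measure_eq_zero_iff_ae_notMem.1 h0] with z hz
    simpa [hWdef, conjKernel_apply, conjDisintegration_apply _ _ _ hB] using hz
  set d : X → ℝ≥0∞ := fun x => (conjKernel D g).rnDeriv D (ψ x) x with hd
  have hdm : Measurable d :=
    (Kernel.measurable_rnDeriv (conjKernel D g) D).comp (hψ.measurable.prodMk measurable_id)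
  have hd_fibre : ∀ᵐ z ∂ρ, ∀ᵐ x ∂(D z), d x = (conjKernel D g).rnDeriv D z x := by
    filter_upwards [hD.ae_fibre] with z hz
    filter_upwards [hz] with x hx
    rw [hd]
    simp only [hx]
  set S : Set X := B ∩ ψ ⁻¹' W with hSdef
  have hS : MeasurableSet S := hB.inter (hψ.measurable hW)
  let v : ℕ → X → ℝ≥0∞ := fun n => S.indicator fun x => min (d x) n
  have hvm : ∀ n, Measurable (v n) := fun n => (hdm.min measurable_const).indicator hS
  have hv_sup : ∀ x, ⨆ n, v n x = S.indicator d x := by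
    intro x
    by_cases hx : x ∈ S
    · simp only [v, Set.indicator_of_mem hx, ← inf_iSup_eq, ENNReal.iSup_natCast]
      simp
    · simp [v, Set.indicator_of_notMem hx]
  have hlt : K⁻¹ * ρ W < ⨆ n, ∫⁻ x, v n x ∂ν := by
    rw [← lintegral_iSup hvm]
    · simp_rw [hv_sup]
      rw [hD.lintegral_eq (hdm.indicator hS)]
      calc K⁻¹ * ρ W < c * ρ W := (ENNReal.mul_lt_mul_iff_left hW0 (measure_ne_top _ _)).2 hKc
        _ = ∫⁻ z, W.indicator (fun _ => c) z ∂ρ := by simp [lintegral_indicator hW]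
        _ ≤ ∫⁻ z, ∫⁻ x, S.indicator d x ∂(D z) ∂ρ := by
          refine lintegral_mono_ae ?_
          filter_upwards [hd_fibre, hD.ae_fibre,
            hD.ae_conjKernel_absolutelyContinuous hν hρ hψ g] with z h1 h2 h3
          by_cases hz : z ∈ W
          · rw [Set.indicator_of_mem hz]
            calc c ≤ conjKernel D g z B := le_of_lt hz
              _ = ∫⁻ x in B, (conjKernel D g).rnDeriv D z x ∂(D z) :=
                (Kernel.setLIntegral_rnDeriv h3 hB).symm
              _ = ∫⁻ x, B.indicator ((conjKernel D g).rnDeriv D z) x ∂(D z) :=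
                (lintegral_indicator hB _).symm
              _ = ∫⁻ x, S.indicator d x ∂(D z) := by
                refine lintegral_congr_ae ?_
                filter_upwards [h1, h2] with x hx1 hx2
                have : x ∈ S ↔ x ∈ B := by simp [hSdef, hx2, hz]
                by_cases hxB : x ∈ B
                · rw [Set.indicator_of_mem hxB, Set.indicator_of_mem (this.2 hxB), hx1]
                · rw [Set.indicator_of_notMem hxB, Set.indicator_of_notMem (mt this.1 hxB)]
          · rw [Set.indicator_of_notMem hz]
            exact zero_le
    · intro m n hmn x
      refine Set.indicator_le_indicator ?_
      gcongr
  obtain ⟨n, hn⟩ := lt_iSup_iff.1 hlt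
  have hv0 : ∫⁻ x, v n x ∂ν ≠ 0 := (zero_le.trans_lt hn).ne'
  have hn0 : (n : ℝ≥0∞) ≠ 0 := by
    intro hn0
    refine hv0 ?_
    simp [v, hn0]
  have hdom : DominatedAlongFibres G ν ρ D K (v n) := by
    refine ⟨W.indicator 1, measurable_one.indicator hW, ?_, ?_⟩
    · rw [lintegral_indicator_one hW]
      have hK0 : K ≠ 0 := (zero_lt_one.trans hK).ne'
      by_cases hKt : K = ∞
      · rw [hKt, ENNReal.top_mul hv0]; exact le_top
      · calc ρ W = K * (K⁻¹ * ρ W) := by rw [← mul_assoc, ENNReal.mul_inv_cancel hK0 hKt, one_mul]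
          _ ≤ _ := by gcongr
    · filter_upwards [hd_fibre, hD.ae_fibre] with z h1 h2 E hE
      by_cases hz : z ∈ W
      · rw [Set.indicator_of_mem hz, Pi.one_apply, one_mul]
        calc ∫⁻ x in E, v n x ∂(D z) ≤ ∫⁻ x in E, (conjKernel D g).rnDeriv D z x ∂(D z) := by
              refine lintegral_mono_ae (ae_restrict_of_ae ?_)
              filter_upwards [h1] with x hx
              rw [← hx]
              exact (Set.indicator_le_self _ _ x).trans (min_le_left _ _)
          _ ≤ conjKernel D g z E := Kernel.setLIntegral_rnDeriv_le hE
          _ ≤ _ := by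
            rw [conjKernel_apply]
            exact le_iSup (fun g : G => conjDisintegration D g z E) g
      · rw [Set.indicator_of_notMem hz, zero_mul, nonpos_iff_eq_zero,
          lintegral_eq_zero_iff (hvm n)]
        refine ae_restrict_of_ae ?_
        filter_upwards [h2] with x hx
        have : x ∉ S := fun hxS => hz (by simpa [hx] using hxS.2)
        simp [v, this]
  refine ⟨fun x => (n : ℝ≥0∞)⁻¹ * v n x, (hvm n).const_mul _, fun x => ?_,
    hdom.const_mul (hvm n) _, ?_⟩
  · by_cases hx : x ∈ S
    · simp only [v, Set.indicator_of_mem hx, Set.indicator_of_mem hx.1, Pi.one_apply]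
      calc (n : ℝ≥0∞)⁻¹ * min (d x) n ≤ (n : ℝ≥0∞)⁻¹ * n := by gcongr; exact min_le_right _ _
        _ = 1 := ENNReal.inv_mul_cancel hn0 (ENNReal.natCast_ne_top n)
    · simp [v, Set.indicator_of_notMem hx]
  · rw [lintegral_const_mul _ (hvm n)]
    exact mul_ne_zero (ENNReal.inv_ne_zero.2 (ENNReal.natCast_ne_top n)) hv0

theorem FillsFibres.dominated_indicator [MeasurableSpace.CountablyGenerated X]
    (h : FillsFibres G ν ρ D) (hν : IsGSpace G ν) (hρ : IsGSpace G ρ)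
    (hψ : IsGMap G ψ ν ρ) (hD : IsDisintegration ψ ν ρ D) (hK : 1 < K) {A : Set X}
    (hA : MeasurableSet A) : DominatedAlongFibres G ν ρ D K (A.indicator 1) := by
  have := hν.isProbabilityMeasure
  have key : ∀ f : X → ℝ≥0∞, Measurable f → ∫⁻ x, f x ∂ν ≠ 0 →
      ∃ u, Measurable u ∧ u ≤ f ∧ DominatedAlongFibres G ν ρ D K u ∧ ∫⁻ x, u x ∂ν ≠ 0 := by
    intro f hf hf0
    obtain ⟨n, hn⟩ : ∃ n : ℕ, ν {x | (n : ℝ≥0∞)⁻¹ ≤ f x} ≠ 0 := by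
      by_contra! hall
      refine hf0 ((lintegral_eq_zero_iff hf).2 ?_)
      filter_upwards [ae_all_iff.2 fun n => measure_eq_zero_iff_ae_notMem.1 (hall n)] with x hx
      by_contra hne
      obtain ⟨n, hn⟩ := ENNReal.exists_inv_nat_lt hne
      exact hx n hn.le
    obtain ⟨u, hu, hle, hdom, hu0⟩ := h.exists_dominated hν hρ hψ hD hK
      (measurableSet_le measurable_const hf) hn
    refine ⟨fun x => (n : ℝ≥0∞)⁻¹ * u x, hu.const_mul _, fun x => ?_, hdom.const_mul hu _, ?_⟩
    · by_cases hx : (n : ℝ≥0∞)⁻¹ ≤ f x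
      · refine le_trans ?_ hx
        refine mul_le_of_le_one_right' ((hle x).trans ?_)
        exact Set.indicator_le_self _ _ x
      · have : u x ≤ 0 := (hle x).trans_eq
          (Set.indicator_of_notMem (s := {x | (n : ℝ≥0∞)⁻¹ ≤ f x}) hx _)
        simp [nonpos_iff_eq_zero.1 this]
    · rw [lintegral_const_mul _ hu]
      exact mul_ne_zero (ENNReal.inv_ne_zero.2 (ENNReal.natCast_ne_top n)) hu0
  obtain ⟨u, hum, hud, hua⟩ := exists_tsum_ae_eq DominatedAlongFibres.zero key
    (measurable_one.indicator hA) (by rw [lintegral_indicator_one hA]; exact measure_ne_top _ _)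
  exact (DominatedAlongFibres.tsum hum hud).congr hD hua

/-- For a fixed set `A`, the domination with constants tending to `1` gives the sharp weight
`D z A`, for all sets `B` simultaneously. -/
theorem FillsFibres.ae_measure_inter_le [MeasurableSpace.CountablyGenerated X]
    (h : FillsFibres G ν ρ D) (hν : IsGSpace G ν) (hρ : IsGSpace G ρ)
    (hψ : IsGMap G ψ ν ρ) (hD : IsDisintegration ψ ν ρ D) {A : Set X} (hA : MeasurableSet A) :
    ∀ᵐ z ∂ρ, ∀ B : Set X, MeasurableSet B →
      D z (A ∩ B) ≤ (⨆ g : G, conjDisintegration D g z B) * D z A := by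
  have := hν.isProbabilityMeasure
  have := hD.isMarkovKernel
  have hK : ∀ n : ℕ, (1 : ℝ≥0∞) < 1 + (n : ℝ≥0∞)⁻¹ := fun n =>
    ENNReal.lt_add_right ENNReal.one_ne_top (ENNReal.inv_ne_zero.2 (ENNReal.natCast_ne_top n))
  choose b hb hbi hbd using fun n => h.dominated_indicator hν hρ hψ hD (hK n) hA
  simp_rw [lintegral_indicator_one hA] at hbi
  have hbd' : ∀ᵐ z ∂ρ, ∀ n, ∀ B : Set X, MeasurableSet B →
      D z (A ∩ B) ≤ b n z * ⨆ g : G, conjDisintegration D g z B := by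
    filter_upwards [ae_all_iff.2 hbd] with z hz n B hB
    have := hz n B hB
    rwa [lintegral_indicator_one hA, Measure.restrict_apply hA] at this
  have hle : (fun z => D z A) ≤ᵐ[ρ] fun z => ⨅ n, b n z := by
    filter_upwards [hbd'] with z hz
    refine le_iInf fun n => ?_
    have := hz n Set.univ MeasurableSet.univ
    rw [Set.inter_univ] at this
    exact this.trans (mul_le_of_le_one_right'
      (iSup_le fun g => conjDisintegration_le_one g z MeasurableSet.univ))
  have hint : ∫⁻ z, ⨅ n, b n z ∂ρ ≤ ∫⁻ z, D z A ∂ρ := by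
    rw [← hD.apply_eq hA]
    have hlim : Filter.Tendsto (fun n : ℕ => (1 + (n : ℝ≥0∞)⁻¹) * ν A) Filter.atTop
        (nhds ((1 + 0) * ν A)) :=
      ENNReal.Tendsto.mul_const (ENNReal.tendsto_inv_nat_nhds_zero.const_add 1)
        (Or.inr (measure_ne_top _ _))
    rw [add_zero, one_mul] at hlim
    exact ge_of_tendsto' hlim fun n => (lintegral_mono fun z => iInf_le _ n).trans (hbi n)
  have heq := ae_eq_of_ae_le_of_lintegral_le hle
    (by rw [← hD.apply_eq hA]; exact measure_ne_top _ _)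
    (Measurable.iInf hb).aemeasurable hint
  filter_upwards [hbd', heq] with z hz he B hB
  have hs : (⨆ g : G, conjDisintegration D g z B) ≠ ∞ := ne_top_of_le_ne_top ENNReal.one_ne_top
    (iSup_le fun g => conjDisintegration_le_one g z hB)
  rw [he, mul_comm, ENNReal.iInf_mul (fun h => absurd h hs)]
  exact le_iInf fun n => hz n B hB

/-- The filling property makes every version of the disintegration satisfy the condition of relative
contractivity, for almost every point of the base and all sets at once. -/
theorem FillsFibres.ae_iSup_eq_one [MeasurableSpace.CountablyGenerated X]
    (h : FillsFibres G ν ρ D) (hν : IsGSpace G ν) (hρ : IsGSpace G ρ)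
    (hψ : IsGMap G ψ ν ρ) (hD : IsDisintegration ψ ν ρ D) :
    ∀ᵐ z ∂ρ, ∀ B : Set X, MeasurableSet B → 0 < D z B →
      ⨆ g : G, conjDisintegration D g z B = 1 := by
  have := hD.isMarkovKernel
  set 𝒜 : Set (Set X) := generateSetAlgebra (MeasurableSpace.countableGeneratingSet X) with h𝒜
  have h𝒜c : 𝒜.Countable :=
    countable_generateSetAlgebra (MeasurableSpace.countable_countableGeneratingSet (α := X))
  have hgen : ‹MeasurableSpace X› = MeasurableSpace.generateFrom 𝒜 := by
    rw [h𝒜, generateFrom_generateSetAlgebra_eq]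
    exact (MeasurableSpace.generateFrom_countableGeneratingSet (α := X)).symm
  have hm : ∀ A ∈ 𝒜, MeasurableSet A := fun A hA =>
    hgen.symm ▸ MeasurableSpace.measurableSet_generateFrom hA
  filter_upwards [(ae_ball_iff h𝒜c).2 fun A hA => h.ae_measure_inter_le hν hρ hψ hD (hm A hA)]
    with z hz B hB hpos
  have hs : (⨆ g : G, conjDisintegration D g z B) ≤ 1 :=
    iSup_le fun g => conjDisintegration_le_one g z hB
  have hle := measure_le_mul_of_measureDense
    (Measure.MeasureDense.of_generateFrom_isSetAlgebra_finite (μ := D z)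
      isSetAlgebra_generateSetAlgebra hgen) hB hs fun A hA => hz A hA B hB
  refine le_antisymm hs ?_
  by_contra hlt
  refine absurd hle (not_le.2 ?_)
  calc (⨆ g : G, conjDisintegration D g z B) * D z B < 1 * D z B :=
        (ENNReal.mul_lt_mul_iff_left hpos.ne' (measure_ne_top _ _)).2 (not_le.1 hlt)
    _ = D z B := one_mul _

end Converse

/-! ### Factors -/

theorem theoremT {G : Type*} [Group G] [TopologicalSpace G] [IsTopologicalGroup G]
    [LocallyCompactSpace G] [SecondCountableTopology G] [T2Space G]
    [MeasurableSpace G] [BorelSpace G]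
    {X : Type*} [MeasurableSpace X] [StandardBorelSpace X] [MulAction G X] [MeasurableSMul₂ G X]
    {Y : Type*} [MeasurableSpace Y] [StandardBorelSpace Y] [MulAction G Y] [MeasurableSMul₂ G Y]
    (ν : Measure X) (η : Measure Y) (hν : IsGSpace G ν) (hη : IsGSpace G η)
    (π : X → Y) (hπ : IsGMap G π ν η) :
    (∀ {Z : Type*} [MeasurableSpace Z] [StandardBorelSpace Z] [MulAction G Z]
      [MeasurableSMul₂ G Z] (ρ : Measure Z), IsGSpace G ρ →
      ∀ φ : Y → Z, IsGMap G φ η ρ →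
        IsRelativelyContractive G (φ ∘ π) ν ρ →
          IsRelativelyContractive G φ η ρ ∧ IsRelativelyContractive G π ν η) ∧
    (IsContractive G ν → IsContractive G η) ∧
    (IsMeasurePreservingSpace G ν → IsMeasurePreservingSpace G η) := by
  have := hν.isProbabilityMeasure
  have := hη.isProbabilityMeasure
  have hπm := hπ.measurable
  have hpre : ∀ (g : G) (B : Set Y), MeasurableSet B →
      ν ((fun x => g • x) ⁻¹' (π ⁻¹' B)) = η ((fun y => g • y) ⁻¹' B) := by
    intro g B hB
    rw [← hπ.map_eq, Measure.map_apply hπm (measurableSet_smul_preimage g hB)]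
    refine measure_congr ?_
    filter_upwards [hπ.equivariant g] with x hx
    exact congrArg (· ∈ B) hx
  refine ⟨?_, ?_, ?_⟩
  · intro Z _ _ _ _ ρ hρ φ hφ h
    have := hρ.isProbabilityMeasure
    refine ⟨fun E hE => ?_, fun D hD => ?_⟩
    · obtain ⟨D, hD⟩ := exists_isDisintegration hπm hπ.map_eq
      exact ((h.fillsFibres hν (hD.comp hE hπm hφ.measurable)).bottom hπ hφ.measurable hD
        hE).ae_iSup_eq_one hη hρ hφ hE
    · obtain ⟨E, hE⟩ := exists_isDisintegration hφ.measurable hφ.map_eq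
      exact ((h.fillsFibres hν (hD.comp hE hπm hφ.measurable)).top hE).ae_iSup_eq_one hν hη hπ hD
  · intro h B hB hpos
    rw [← hπ.map_eq, Measure.map_apply hπm hB] at hpos
    rw [← h _ (hπm hB) hpos]
    refine iSup_congr fun g => ?_
    rw [Set.image_smul, Set.image_smul, ← Set.preimage_smul_inv, ← Set.preimage_smul_inv]
    exact (hpre g⁻¹ B hB).symm
  · intro h g
    ext B hB
    rw [measureTranslate, Measure.map_apply (measurable_const_smul g) hB, ← hpre g B hB,
      ← Measure.map_apply (measurable_const_smul g) (hπm hB)]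
    change measureTranslate g ν (π ⁻¹' B) = η B
    rw [h g, ← hπ.map_eq, Measure.map_apply hπm hB]
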